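/- Let $A,Q\in\mathbb R^{n\times n}$, $B,L\in\mathbb R^{n\times m}$, $R\in\mathbb R^{m\times m}$, and $A_0^i\in\mathbb R^{n\times n}$, $B_0^i\in\mathbb R^{n\times m}$ for $i=1,\dots,r$. Assume that $R$ is symmetric positive definite and that $Q-LR^{-1}L^{\top}=C^{\top}C$ for some $C\in\mathbb R^{l\times n}$ with $$\ker C\subseteq\Big(\bigcap_{i=1}^r\ker A_0^i\Big)\cap\ker L^{\top}.$$ Call a real square matrix stable if all its eigenvalues have negative real part. Assume that $(A,B)$ is stabilizable (there is a real matrix $F$ such that $A+BF$ is stable) and that $(C,A)$ is detectable (that is, $(A^{\top},C^{\top})$ is stabilizable). Given a symmetric positive semidefinite matrix $X_k\in\mathbb R^{n\times n}$, put $$Q_k=Q+\sum_{i=1}^r A_0^{i\top}X_kA_0^i,\qquad L_k=L+\sum_{i=1}^r A_0^{i\top}X_kB_0^i,\qquad R_k=R+\sum_{i=1}^r B_0^{i\top}X_kB_0^i,$$ $$A_k=A-BR_k^{-1}L_k^{\top},\qquad G_k=BR_k^{-1}B^{\top},\qquad H_k=Q_k-L_kR_k^{-1}L_k^{\top}.$$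 Then for every such $X_k$ the algebraic Riccati equation $$A_k^{\top}X+XA_k-XG_kX+H_k=0$$ has a unique positive semidefinite stabilizing solution; that is, there is exactly one symmetric positive semidefinite matrix $X=X_{k+1}\in\mathbb R^{n\times n}$ that satisfies the equation and for which $A_k-G_kX$ is stable. -/

import Mathlib

open scoped Matrix

noncomputable section

namespace SCARE

/-- A real square matrix is stable (Hurwitz): every complex eigenvalue has negative real part. -/
def IsStable {n : ℕ} (A : Matrix (Fin n) (Fin n) ℝ) : Prop :=
  ∀ z ∈ spectrum ℂ (A.map (algebraMap ℝ ℂ)), z.re < 0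

/-- The pair `(A, B)` is stabilizable: some real state feedback `F` makes `A + B F` stable. -/
def IsStabilizable {n m : ℕ} (A : Matrix (Fin n) (Fin n) ℝ) (B : Matrix (Fin n) (Fin m) ℝ) :
    Prop :=
  ∃ F : Matrix (Fin m) (Fin n) ℝ, IsStable (A + B * F)

/-- The pair `(C, A)` is detectable: the dual pair `(Aᵀ, Cᵀ)` is stabilizable. -/
def IsDetectable {l n : ℕ} (C : Matrix (Fin l) (Fin n) ℝ) (A : Matrix (Fin n) (Fin n) ℝ) :
    Prop :=
  IsStabilizable Aᵀ Cᵀ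

variable {n m r : ℕ}

/-- `Q_c(X) = Q + ∑ᵢ (A₀ⁱ)ᵀ X A₀ⁱ`. -/
def Qc (Q : Matrix (Fin n) (Fin n) ℝ) (A₀ : Fin r → Matrix (Fin n) (Fin n) ℝ)
    (X : Matrix (Fin n) (Fin n) ℝ) : Matrix (Fin n) (Fin n) ℝ :=
  Q + ∑ i, (A₀ i)ᵀ * X * A₀ i

/-- `L_c(X) = L + ∑ᵢ (A₀ⁱ)ᵀ X B₀ⁱ`. -/
def Lc (L : Matrix (Fin n) (Fin m) ℝ) (A₀ : Fin r → Matrix (Fin n) (Fin n) ℝ)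
    (B₀ : Fin r → Matrix (Fin n) (Fin m) ℝ) (X : Matrix (Fin n) (Fin n) ℝ) :
    Matrix (Fin n) (Fin m) ℝ :=
  L + ∑ i, (A₀ i)ᵀ * X * B₀ i

/-- `R_c(X) = R + ∑ᵢ (B₀ⁱ)ᵀ X B₀ⁱ`. -/
def Rc (R : Matrix (Fin m) (Fin m) ℝ) (B₀ : Fin r → Matrix (Fin n) (Fin m) ℝ)
    (X : Matrix (Fin n) (Fin n) ℝ) : Matrix (Fin m) (Fin m) ℝ :=
  R + ∑ i, (B₀ i)ᵀ * X * B₀ i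

/-- `A_c(X) = A - B R_c(X)⁻¹ L_c(X)ᵀ`. -/
def Ac (A : Matrix (Fin n) (Fin n) ℝ) (B L : Matrix (Fin n) (Fin m) ℝ)
    (R : Matrix (Fin m) (Fin m) ℝ) (A₀ : Fin r → Matrix (Fin n) (Fin n) ℝ)
    (B₀ : Fin r → Matrix (Fin n) (Fin m) ℝ) (X : Matrix (Fin n) (Fin n) ℝ) :
    Matrix (Fin n) (Fin n) ℝ :=
  A - B * (Rc R B₀ X)⁻¹ * (Lc L A₀ B₀ X)ᵀ

/-- `G_c(X) = B R_c(X)⁻¹ Bᵀ`. -/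
def Gc (B : Matrix (Fin n) (Fin m) ℝ) (R : Matrix (Fin m) (Fin m) ℝ)
    (B₀ : Fin r → Matrix (Fin n) (Fin m) ℝ) (X : Matrix (Fin n) (Fin n) ℝ) :
    Matrix (Fin n) (Fin n) ℝ :=
  B * (Rc R B₀ X)⁻¹ * Bᵀ

/-- `H_c(X) = Q_c(X) - L_c(X) R_c(X)⁻¹ L_c(X)ᵀ`. -/
def Hc (Q : Matrix (Fin n) (Fin n) ℝ) (L : Matrix (Fin n) (Fin m) ℝ)
    (R : Matrix (Fin m) (Fin m) ℝ) (A₀ : Fin r → Matrix (Fin n) (Fin n) ℝ)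
    (B₀ : Fin r → Matrix (Fin n) (Fin m) ℝ) (X : Matrix (Fin n) (Fin n) ℝ) :
    Matrix (Fin n) (Fin n) ℝ :=
  Qc Q A₀ X - Lc L A₀ B₀ X * (Rc R B₀ X)⁻¹ * (Lc L A₀ B₀ X)ᵀ

/-- `X` solves the continuous-time algebraic Riccati equation `Aᵀ X + X A - X G X + H = 0`. -/
def SolvesCARE (A G H X : Matrix (Fin n) (Fin n) ℝ) : Prop :=
  Aᵀ * X + X * A - X * G * X + H = 0

/-- `X` is a positive semidefinite (in particular symmetric) solution of
`Aᵀ X + X A - X G X + H = 0` that is stabilizing: the closed-loop matrix `A - G X` is stable. -/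
def IsPSDStabilizingSolution (A G H X : Matrix (Fin n) (Fin n) ℝ) : Prop :=
  X.PosSemidef ∧ SolvesCARE A G H X ∧ IsStable (A - G * X)

end SCARE

end

/-! With `K = R_k⁻¹ L_kᵀ`, the matrix `H_k` is `CᵀC` plus two positive semidefinite terms. If `H_k c
= 0`, then `C c = 0`, hence `Lᵀ c = 0` and `K c = 0`, so `A_k = A - B K` acts on `c` as `A`;
detectability of `(C, A)` therefore passes to `(H_k, A_k)`. Stabilizability passes to `A_k` by
shifting the feedback.

Existence is variational. A stabilizing feedback gives a semidefinite solution of the Riccati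
inequality. Such solutions are all stabilizing, those of bounded trace form a compact set, and a
Newton step from one of minimal trace cannot move, so it solves the equation. Uniqueness: the
difference of two stabilizing solutions is semidefinite in both directions. -/

noncomputable section
namespace SCARE

open Filter Topology

/-! ### Hurwitz stability in real terms, and the Cayley transform. -/

section Stability

variable {n : ℕ}

/-- `a + i b` lies in an eigenspace of the real matrix `M` for the eigenvalue `σ + i τ`, where
`0 ≤ σ`. The vector may be zero. -/
def IsUnstablePair (M : Matrix (Fin n) (Fin n) ℝ) (a b : Fin n → ℝ) : Prop :=
  ∃ σ τ : ℝ, 0 ≤ σ ∧ M *ᵥ a = σ • a - τ • b ∧ M *ᵥ b = τ • a + σ • b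

theorem mem_spectrum_iff_exists_mulVec {K : Type*} [Field K] (M : Matrix (Fin n) (Fin n) K)
    (z : K) : z ∈ spectrum K M ↔ ∃ v ≠ 0, M *ᵥ v = z • v := by
  rw [spectrum.mem_iff, Matrix.isUnit_iff_isUnit_det, isUnit_iff_ne_zero, not_not,
    ← Matrix.exists_mulVec_eq_zero_iff]
  refine exists_congr fun v => and_congr_right fun _ => ?_
  rw [Matrix.sub_mulVec, Algebra.algebraMap_eq_smul_one, Matrix.smul_mulVec, Matrix.one_mulVec,
    sub_eq_zero, eq_comm]

theorem map_algebraMap_mulVec_re (M : Matrix (Fin n) (Fin n) ℝ) (v : Fin n → ℂ) (i : Fin n) :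
    ((M.map (algebraMap ℝ ℂ) *ᵥ v) i).re = (M *ᵥ fun j => (v j).re) i := by
  simp [Matrix.mulVec, dotProduct]

theorem map_algebraMap_mulVec_im (M : Matrix (Fin n) (Fin n) ℝ) (v : Fin n → ℂ) (i : Fin n) :
    ((M.map (algebraMap ℝ ℂ) *ᵥ v) i).im = (M *ᵥ fun j => (v j).im) i := by
  simp [Matrix.mulVec, dotProduct]

theorem isStable_iff_forall_mulVec (M : Matrix (Fin n) (Fin n) ℝ) :
    IsStable M ↔
      ∀ (z : ℂ) (v : Fin n → ℂ), v ≠ 0 → M.map (algebraMap ℝ ℂ) *ᵥ v = z • v → z.re < 0 := by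
  simp only [IsStable, mem_spectrum_iff_exists_mulVec]
  exact ⟨fun h z v hv hz => h z ⟨v, hv, hz⟩, fun h z ⟨v, hv, hz⟩ => h z v hv hz⟩

theorem isStable_iff_forall_isUnstablePair (M : Matrix (Fin n) (Fin n) ℝ) :
    IsStable M ↔ ∀ a b, IsUnstablePair M a b → a = 0 ∧ b = 0 := by
  rw [isStable_iff_forall_mulVec]
  constructor
  · rintro h a b ⟨σ, τ, hσ, ha, hb⟩
    by_contra hab
    refine (h ⟨σ, τ⟩ (fun i => ⟨a i, b i⟩) (fun h0 => hab ⟨?_, ?_⟩) ?_).not_ge hσ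
    · ext i
      simpa using congrArg Complex.re (congrFun h0 i)
    · ext i
      simpa using congrArg Complex.im (congrFun h0 i)
    · ext i
      apply Complex.ext
      · rw [map_algebraMap_mulVec_re]
        simpa using congrFun ha i
      · rw [map_algebraMap_mulVec_im]
        have := congrFun hb i
        simp only [Pi.add_apply, Pi.smul_apply, smul_eq_mul] at this
        simp only [Pi.smul_apply, smul_eq_mul, Complex.mul_im]
        rw [this, add_comm]
  · intro h z v hv hz
    by_contra! hre
    have hp : IsUnstablePair M (fun i => (v i).re) (fun i => (v i).im) := by
      refine ⟨z.re, z.im, hre, ?_, ?_⟩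
      · ext i
        rw [← map_algebraMap_mulVec_re, hz]
        simp
      · ext i
        rw [← map_algebraMap_mulVec_im, hz]
        simp [add_comm]
    obtain ⟨ha, hb⟩ := h _ _ hp
    exact hv (funext fun i => Complex.ext (congrFun ha i) (congrFun hb i))

theorem IsStable.of_transpose {M : Matrix (Fin n) (Fin n) ℝ} (h : IsStable Mᵀ) : IsStable M := by
  intro z hz
  refine h z ?_
  rw [Matrix.transpose_map, Matrix.mem_spectrum_iff_isRoot_charpoly, Matrix.charpoly_transpose]
  exact Matrix.mem_spectrum_iff_isRoot_charpoly.1 hz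

/-- Powers of a complex matrix with spectrum in the open unit disc tend to zero. -/
theorem tendsto_pow_of_spectrum_norm_lt_one (N : Matrix (Fin n) (Fin n) ℂ)
    (h : ∀ z ∈ spectrum ℂ N, ‖z‖ < 1) : Tendsto (fun k : ℕ => N ^ k) atTop (𝓝 0) := by
  rcases n.eq_zero_or_pos with rfl | hn
  · exact tendsto_const_nhds.congr fun k => Subsingleton.elim _ _
  have : Nonempty (Fin n) := ⟨⟨0, hn⟩⟩
  let : NormedRing (Matrix (Fin n) (Fin n) ℂ) := Matrix.linftyOpNormedRing
  let : NormedAlgebra ℂ (Matrix (Fin n) (Fin n) ℂ) := Matrix.linftyOpNormedAlgebra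
  have hr : spectralRadius ℂ N < 1 :=
    spectrum.spectralRadius_lt_of_forall_lt N fun z hz => by
      exact_mod_cast h z hz
  obtain ⟨r, hr1, hr2⟩ := ENNReal.lt_iff_exists_nnreal_btwn.1 hr
  have hr2 : r < 1 := by exact_mod_cast hr2
  -- Gelfand's formula: eventually `‖N ^ k‖ ^ (1 / k) < r < 1`.
  have hg := (spectrum.pow_nnnorm_pow_one_div_tendsto_nhds_spectralRadius N).eventually_lt_const hr1
  refine tendsto_zero_iff_norm_tendsto_zero.2 ?_
  refine squeeze_zero' (.of_forall fun k => norm_nonneg _) ?_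
    (tendsto_pow_atTop_nhds_zero_of_lt_one r.coe_nonneg hr2)
  filter_upwards [hg, eventually_gt_atTop 0] with k hk hk0
  have hk' : (‖N ^ k‖₊ : ENNReal) < r ^ k := by
    have := ENNReal.rpow_lt_rpow hk (show (0 : ℝ) < k by exact_mod_cast hk0)
    rwa [← ENNReal.rpow_mul, one_div, inv_mul_cancel₀ (by positivity), ENNReal.rpow_one,
      ENNReal.rpow_natCast] at this
  have : ‖N ^ k‖₊ < r ^ k := by exact_mod_cast hk'
  exact_mod_cast this.le

/-- The Cayley transform of a matrix. -/
def cayley (M : Matrix (Fin n) (Fin n) ℝ) : Matrix (Fin n) (Fin n) ℝ := (M + 1) * (M - 1)⁻¹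

theorem IsStable.isUnit_det_sub_one {M : Matrix (Fin n) (Fin n) ℝ} (h : IsStable M) :
    IsUnit (M - 1).det := by
  rw [isUnit_iff_ne_zero]
  intro h0
  obtain ⟨v, hv, hMv⟩ := Matrix.exists_mulVec_eq_zero_iff.2 h0
  rw [Matrix.sub_mulVec, Matrix.one_mulVec, sub_eq_zero] at hMv
  exact hv ((isStable_iff_forall_isUnstablePair M).1 h v 0
    ⟨1, 0, zero_le_one, by simpa using hMv, by simp⟩).1

theorem IsStable.cayley_mul {M : Matrix (Fin n) (Fin n) ℝ} (h : IsStable M) :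
    cayley M * (M - 1) = M + 1 := by
  rw [cayley, Matrix.mul_assoc, Matrix.nonsing_inv_mul _ h.isUnit_det_sub_one, Matrix.mul_one]

theorem Complex.norm_lt_one_of_cayley {z : ℂ} (hz : z ≠ 1) (h : ((z + 1) / (z - 1)).re < 0) :
    ‖z‖ < 1 := by
  have hz' : 0 < Complex.normSq (z - 1) := Complex.normSq_pos.2 (sub_ne_zero.2 hz)
  rw [Complex.div_re, ← add_div, div_neg_iff] at h
  rcases h with h | h
  · exact absurd hz' h.2.not_gt
  · have h1 := h.1
    simp only [Complex.add_re, Complex.sub_re, Complex.add_im, Complex.sub_im, Complex.one_re,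
      Complex.one_im] at h1
    rw [← sq_lt_one_iff₀ (norm_nonneg z), Complex.sq_norm, Complex.normSq_apply]
    nlinarith

/-- If `(M - 1) w` is an eigenvector of the transform for `z`, then `w` is one of `M` for `(z + 1) /
(z - 1)`; a negative real part there forces `‖z‖ < 1`. -/
theorem IsStable.tendsto_cayley_pow {M : Matrix (Fin n) (Fin n) ℝ} (h : IsStable M) :
    Tendsto (fun k : ℕ => cayley M ^ k) atTop (𝓝 0) := by
  let f : Matrix (Fin n) (Fin n) ℝ →+* Matrix (Fin n) (Fin n) ℂ := (algebraMap ℝ ℂ).mapMatrix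
  have hmul : f (cayley M) * (f M - 1) = f M + 1 := by
    rw [← map_one f, ← map_sub, ← map_mul, h.cayley_mul, map_add]
  have hU : IsUnit (f M - 1) := by
    rw [← map_one f, ← map_sub]
    exact ((Matrix.isUnit_iff_isUnit_det _).2 h.isUnit_det_sub_one).map f
  have hc : Tendsto (fun k : ℕ => f (cayley M) ^ k) atTop (𝓝 0) := by
    refine tendsto_pow_of_spectrum_norm_lt_one _ fun z hz => ?_
    obtain ⟨v, hv, hzv⟩ := (mem_spectrum_iff_exists_mulVec _ _).1 hz
    obtain ⟨w, rfl⟩ := Matrix.mulVec_surjective_iff_isUnit.2 hU v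
    have hw : w ≠ 0 := by
      rintro rfl
      exact hv (Matrix.mulVec_zero _)
    rw [Matrix.mulVec_mulVec, hmul, Matrix.add_mulVec, Matrix.sub_mulVec, Matrix.one_mulVec] at hzv
    have hz1 : z ≠ 1 := by
      rintro rfl
      rw [one_smul, sub_eq_add_neg, add_right_inj] at hzv
      exact hw (self_eq_neg.1 hzv)
    refine Complex.norm_lt_one_of_cayley hz1
      ((isStable_iff_forall_mulVec M).1 h _ w hw ?_)
    have hz2 : z - 1 ≠ 0 := sub_ne_zero.2 hz1
    ext i
    have := congrFun hzv i
    simp only [Pi.add_apply, Pi.smul_apply, Pi.sub_apply, smul_eq_mul] at this ⊢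
    rw [div_mul_eq_mul_div, eq_div_iff hz2]
    change (f M *ᵥ w) i * _ = _
    linear_combination -this
  have hre : Continuous fun Z : Matrix (Fin n) (Fin n) ℂ => Z.map Complex.re := by fun_prop
  have ht := (hre.tendsto 0).comp hc
  rw [Matrix.map_zero _ Complex.zero_re] at ht
  refine ht.congr fun k => ?_
  rw [Function.comp_apply, ← map_pow]
  ext i j
  exact Complex.ofReal_re _

end Stability

/-! ### Lyapunov equations. -/

section Lyapunov

variable {n : ℕ} {M D W : Matrix (Fin n) (Fin n) ℝ}

/-- The Cayley transform makes the equation discrete, so powers of a matrix replace the integral of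
matrix exponentials. -/
theorem IsStable.stein_of_lyapunov (h : IsStable M) (hD : Mᵀ * D + D * M + W = 0) :
    D - (cayley M)ᵀ * D * cayley M = ((M - 1)⁻¹)ᵀ * ((2 : ℝ) • W) * (M - 1)⁻¹ := by
  have hu := Matrix.mul_nonsing_inv _ h.isUnit_det_sub_one
  have hut : ((M - 1)⁻¹)ᵀ * (M - 1)ᵀ = 1 := by
    rw [← Matrix.transpose_mul, hu, Matrix.transpose_one]
  have hW : (2 : ℝ) • W = (M - 1)ᵀ * D * (M - 1) - (M + 1)ᵀ * D * (M + 1) := by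
    rw [eq_neg_of_add_eq_zero_right hD, two_smul, Matrix.transpose_sub, Matrix.transpose_add,
      Matrix.transpose_one]
    noncomm_ring
  calc
    _ = (((M - 1)⁻¹)ᵀ * (M - 1)ᵀ) * D * ((M - 1) * (M - 1)⁻¹)
        - (cayley M)ᵀ * D * cayley M := by rw [hu, hut]; simp
    _ = _ := by
      rw [hW, cayley, Matrix.transpose_mul]
      noncomm_ring

theorem IsStable.tendsto_conj_cayley_pow (h : IsStable M) (D : Matrix (Fin n) (Fin n) ℝ) :
    Tendsto (fun k : ℕ => (cayley M ^ k)ᵀ * D * cayley M ^ k) atTop (𝓝 0) := by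
  have hc : Continuous fun N : Matrix (Fin n) (Fin n) ℝ => Nᵀ * D * N := by fun_prop
  have := (hc.tendsto 0).comp h.tendsto_cayley_pow
  rwa [Matrix.mul_zero] at this

theorem IsStable.eq_zero_of_lyapunov (h : IsStable M) (hD : Mᵀ * D + D * M = 0) : D = 0 := by
  have hs := h.stein_of_lyapunov (W := 0) (by rwa [add_zero])
  rw [smul_zero, Matrix.mul_zero, Matrix.zero_mul, sub_eq_zero] at hs
  have hk : ∀ k : ℕ, (cayley M ^ k)ᵀ * D * cayley M ^ k = D := by
    intro k
    induction k with
    | zero => simp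
    | succ k ih =>
      calc _ = (cayley M ^ k)ᵀ * ((cayley M)ᵀ * D * cayley M) * cayley M ^ k := by
            rw [pow_succ', Matrix.transpose_mul]
            noncomm_ring
        _ = D := by rw [← hs, ih]
  exact tendsto_nhds_unique (tendsto_const_nhds.congr fun k => (hk k).symm)
    (h.tendsto_conj_cayley_pow D)

theorem isClosed_setOf_posSemidef : IsClosed {X : Matrix (Fin n) (Fin n) ℝ | X.PosSemidef} := by
  simp only [Matrix.posSemidef_iff_dotProduct_mulVec, Set.ofPred_and, Set.ofPred_forall]
  refine (isClosed_eq (f := fun X : Matrix (Fin n) (Fin n) ℝ => Xᴴ) ?_ continuous_id).inter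
    (isClosed_iInter fun x => isClosed_le continuous_const ?_)
  all_goals fun_prop

/-- The solution of the Lyapunov equation of a stable matrix with positive semidefinite right-hand
side is positive semidefinite. -/
theorem IsStable.posSemidef_of_lyapunov (h : IsStable M) (hW : W.PosSemidef)
    (hD : Mᵀ * D + D * M + W = 0) : D.PosSemidef := by
  have hs := h.stein_of_lyapunov hD
  have hP : (D - (cayley M)ᵀ * D * cayley M).PosSemidef := by
    rw [hs]
    exact (hW.smul zero_le_two).conjTranspose_mul_mul_same _
  -- Telescoping: this is a sum of congruences of the matrix in `hP`.
  have hk : ∀ k : ℕ, (D - (cayley M ^ k)ᵀ * D * cayley M ^ k).PosSemidef := by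
    intro k
    induction k with
    | zero => simpa using Matrix.PosSemidef.zero
    | succ k ih =>
      have := ih.add (hP.conjTranspose_mul_mul_same (cayley M ^ k))
      convert! this using 1
      rw [pow_succ', Matrix.transpose_mul, Matrix.conjTranspose_eq_transpose_of_trivial]
      noncomm_ring
  have ht := (h.tendsto_conj_cayley_pow D).const_sub D
  rw [sub_zero] at ht
  exact isClosed_setOf_posSemidef.mem_of_tendsto ht (.of_forall hk)

theorem IsStable.exists_lyapunov (h : IsStable M) (W : Matrix (Fin n) (Fin n) ℝ) :
    ∃ D, Mᵀ * D + D * M + W = 0 := by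
  let f : Matrix (Fin n) (Fin n) ℝ →ₗ[ℝ] Matrix (Fin n) (Fin n) ℝ :=
    LinearMap.mulLeft ℝ Mᵀ + LinearMap.mulRight ℝ M
  have hf : Function.Injective f := by
    rw [injective_iff_map_eq_zero]
    exact fun D hD => h.eq_zero_of_lyapunov hD
  obtain ⟨D, hD⟩ := LinearMap.injective_iff_surjective.1 hf (-W)
  exact ⟨D, eq_neg_iff_add_eq_zero.1 hD⟩

theorem dotProduct_lyapunov_mulVec (M X : Matrix (Fin n) (Fin n) ℝ) (a : Fin n → ℝ) :
    a ⬝ᵥ (Mᵀ * X + X * M) *ᵥ a = (M *ᵥ a) ⬝ᵥ X *ᵥ a + a ⬝ᵥ X *ᵥ (M *ᵥ a) := by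
  rw [Matrix.add_mulVec, dotProduct_add, ← Matrix.mulVec_mulVec, ← Matrix.mulVec_mulVec,
    Matrix.dotProduct_mulVec a Mᵀ, Matrix.vecMul_transpose]

/-- The Lyapunov stability criterion with a semidefinite right-hand side. -/
theorem isStable_of_lyapunov {X : Matrix (Fin n) (Fin n) ℝ} (hX : X.PosSemidef)
    (hW : W.PosSemidef) (hXW : Mᵀ * X + X * M + W = 0)
    (hker : ∀ a b, IsUnstablePair M a b → W *ᵥ a = 0 → W *ᵥ b = 0 → a = 0 ∧ b = 0) :
    IsStable M := by
  rw [isStable_iff_forall_isUnstablePair]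
  rintro a b ⟨σ, τ, hσ, ha, hb⟩
  have hquad : ∀ c, c ⬝ᵥ W *ᵥ c = -(c ⬝ᵥ (Mᵀ * X + X * M) *ᵥ c) := by
    intro c
    rw [eq_neg_of_add_eq_zero_right hXW, Matrix.neg_mulVec, dotProduct_neg]
  have hnn : ∀ {Y : Matrix (Fin n) (Fin n) ℝ}, Y.PosSemidef → ∀ c, 0 ≤ c ⬝ᵥ Y *ᵥ c :=
    fun hY c => hY.dotProduct_mulVec_nonneg c
  have hzero : ∀ c, c ⬝ᵥ W *ᵥ c = 0 → W *ᵥ c = 0 :=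
    fun c => (hW.dotProduct_mulVec_zero_iff c).1
  -- The cross terms in `τ` cancel in the sum. The left side is nonnegative and the right side
  -- nonpositive, so both vanish.
  have key : a ⬝ᵥ W *ᵥ a + b ⬝ᵥ W *ᵥ b = -(2 * σ * (a ⬝ᵥ X *ᵥ a + b ⬝ᵥ X *ᵥ b)) := by
    rw [hquad, hquad, dotProduct_lyapunov_mulVec, dotProduct_lyapunov_mulVec, ha, hb]
    simp only [Matrix.mulVec_sub, Matrix.mulVec_add, Matrix.mulVec_smul, dotProduct_sub,
      dotProduct_add, dotProduct_smul, sub_dotProduct, add_dotProduct, smul_dotProduct,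
      smul_eq_mul]
    ring
  have hXab := mul_nonneg (mul_nonneg zero_le_two hσ) (add_nonneg (hnn hX a) (hnn hX b))
  have hWa := hnn hW a
  have hWb := hnn hW b
  exact hker a b ⟨σ, τ, hσ, ha, hb⟩ (hzero a (by linarith)) (hzero b (by linarith))

end Lyapunov

/-! ### Kernels and entries of semidefinite matrices. -/

section Semidefinite

variable {n : ℕ} {P S X : Matrix (Fin n) (Fin n) ℝ}

theorem transpose_eq_of_posSemidef (hX : X.PosSemidef) : Xᵀ = X := by
  rw [← Matrix.conjTranspose_eq_transpose_of_trivial, hX.1.eq]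

theorem mulVec_eq_zero_of_add (hP : P.PosSemidef) (hS : S.PosSemidef) {a : Fin n → ℝ}
    (h : (P + S) *ᵥ a = 0) : P *ᵥ a = 0 ∧ S *ᵥ a = 0 := by
  have h1 := hP.dotProduct_mulVec_nonneg a
  have h2 := hS.dotProduct_mulVec_nonneg a
  have h3 : star a ⬝ᵥ P *ᵥ a + star a ⬝ᵥ S *ᵥ a = 0 := by
    rw [← dotProduct_add, ← Matrix.add_mulVec, h, dotProduct_zero]
  exact ⟨(hP.dotProduct_mulVec_zero_iff a).1 (by linarith),
    (hS.dotProduct_mulVec_zero_iff a).1 (by linarith)⟩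

theorem mulVec_eq_zero_of_transpose_mul_mul {m : ℕ} {T : Matrix (Fin m) (Fin m) ℝ}
    {K : Matrix (Fin m) (Fin n) ℝ} (hT : T.PosSemidef) {a : Fin n → ℝ}
    (h : (Kᵀ * T * K) *ᵥ a = 0) : T *ᵥ K *ᵥ a = 0 := by
  refine (hT.dotProduct_mulVec_zero_iff _).1 ?_
  have := congrArg (a ⬝ᵥ ·) h
  simpa [← Matrix.mulVec_mulVec, Matrix.dotProduct_mulVec a Kᵀ, Matrix.vecMul_transpose] using this

/-- Testing on `eᵢ ± eⱼ` bounds the entry by the mean of two diagonal entries. This gives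
compactness of trace-bounded sets. -/
theorem abs_apply_le_trace (hX : X.PosSemidef) (i j : Fin n) : |X i j| ≤ X.trace := by
  have hd : ∀ k, 0 ≤ X k k := fun k => hX.diag_nonneg
  have hk : ∀ k, X k k ≤ X.trace := fun k =>
    Finset.single_le_sum (f := fun k => X k k) (fun k _ => hd k) (Finset.mem_univ k)
  have hs : X j i = X i j := congrFun (congrFun (transpose_eq_of_posSemidef hX) i) j
  have h1 := hX.dotProduct_mulVec_nonneg (Pi.single i 1 + Pi.single j 1)
  have h2 := hX.dotProduct_mulVec_nonneg (Pi.single i 1 - Pi.single j 1)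
  simp [Matrix.mulVec_add, Matrix.mulVec_sub, add_dotProduct, sub_dotProduct] at h1 h2
  rw [abs_le]
  constructor <;> linarith [hk i, hk j]

end Semidefinite

/-! ### Riccati inequality, Newton step, existence and uniqueness. -/

section Riccati

variable {n : ℕ} {A G H X Y : Matrix (Fin n) (Fin n) ℝ}

/-- The left-hand side of the Riccati equation. -/
def riccati (A G H X : Matrix (Fin n) (Fin n) ℝ) : Matrix (Fin n) (Fin n) ℝ :=
  Aᵀ * X + X * A - X * G * X + H

/-- The positive semidefinite solutions of the Riccati inequality `riccati A G H X ≤ 0`. -/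
def riccatiSupersolutions (A G H : Matrix (Fin n) (Fin n) ℝ) : Set (Matrix (Fin n) (Fin n) ℝ) :=
  {X | X.PosSemidef ∧ (-riccati A G H X).PosSemidef}

theorem isClosed_riccatiSupersolutions (A G H : Matrix (Fin n) (Fin n) ℝ) :
    IsClosed (riccatiSupersolutions A G H) := by
  have hc : Continuous fun X => -riccati A G H X := by
    unfold riccati
    fun_prop
  exact isClosed_setOf_posSemidef.inter (isClosed_setOf_posSemidef.preimage hc)

/-- No nonzero element of an unstable eigenspace of `A` is annihilated by `H`. -/
def HasNoUnstableUnobservable (A H : Matrix (Fin n) (Fin n) ℝ) : Prop :=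
  ∀ a b, IsUnstablePair A a b → H *ᵥ a = 0 → H *ᵥ b = 0 → a = 0 ∧ b = 0

/-- `X` solves the closed-loop Lyapunov equation with right-hand side `H + X G X - riccati X`. Where
this vanishes, `G X c = 0`, so the closed loop acts as `A`. -/
theorem isStable_of_mem_riccatiSupersolutions (hG : G.PosSemidef) (hH : H.PosSemidef)
    (hd : HasNoUnstableUnobservable A H) (hX : X ∈ riccatiSupersolutions A G H) :
    IsStable (A - G * X) := by
  have hXt := transpose_eq_of_posSemidef hX.1
  have hXGX : (Xᵀ * G * X).PosSemidef := hG.conjTranspose_mul_mul_same X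
  refine isStable_of_lyapunov hX.1 ((hH.add hXGX).add hX.2) ?_ ?_
  · rw [riccati, Matrix.transpose_sub, Matrix.transpose_mul, hXt, transpose_eq_of_posSemidef hG]
    noncomm_ring
  · have hker : ∀ c, (H + Xᵀ * G * X + -riccati A G H X) *ᵥ c = 0 →
        H *ᵥ c = 0 ∧ (A - G * X) *ᵥ c = A *ᵥ c := by
      intro c hc
      obtain ⟨h1, h2⟩ := mulVec_eq_zero_of_add hH hXGX
        (mulVec_eq_zero_of_add (hH.add hXGX) hX.2 hc).1
      refine ⟨h1, ?_⟩
      rw [Matrix.sub_mulVec, ← Matrix.mulVec_mulVec, mulVec_eq_zero_of_transpose_mul_mul hG h2,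
        sub_zero]
    rintro a b ⟨σ, τ, hσ, ha, hb⟩ hWa hWb
    rw [(hker a hWa).2] at ha
    rw [(hker b hWb).2] at hb
    exact hd a b ⟨σ, τ, hσ, ha, hb⟩ (hker a hWa).1 (hker b hWb).1

/-- One Newton step produces a smaller supersolution. -/
theorem exists_newton_step (hG : G.PosSemidef) (hH : H.PosSemidef)
    (hd : HasNoUnstableUnobservable A H) (hX : X ∈ riccatiSupersolutions A G H) :
    ∃ Y ∈ riccatiSupersolutions A G H, (X - Y).PosSemidef ∧
      riccati A G H Y = -((X - Y) * G * (X - Y)) := by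
  have hst := isStable_of_mem_riccatiSupersolutions hG hH hd hX
  have hXt := transpose_eq_of_posSemidef hX.1
  have hXGX : (Xᵀ * G * X).PosSemidef := hG.conjTranspose_mul_mul_same X
  obtain ⟨Y, hY⟩ := hst.exists_lyapunov (H + Xᵀ * G * X)
  have hYP := hst.posSemidef_of_lyapunov (hH.add hXGX) hY
  have hD : (X - Y).PosSemidef := by
    refine hst.posSemidef_of_lyapunov hX.2 ?_
    rw [← neg_eq_zero, ← hY, riccati, Matrix.transpose_sub, Matrix.transpose_mul, hXt, transpose_eq_of_posSemidef hG]
    noncomm_ring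
  have hric : riccati A G H Y = -((X - Y) * G * (X - Y)) := by
    rw [Matrix.transpose_sub, Matrix.transpose_mul, hXt, transpose_eq_of_posSemidef hG] at hY
    rw [← sub_zero (riccati A G H Y), ← hY, riccati]
    noncomm_ring
  refine ⟨Y, ⟨hYP, ?_⟩, hD, hric⟩
  rw [hric, neg_neg]
  have := hG.conjTranspose_mul_mul_same (X - Y)
  rwa [hD.1.eq] at this

/-- Two stabilizing solutions of the Riccati equation coincide. -/
theorem IsPSDStabilizingSolution.unique (hG : G.PosSemidef)
    (hX : IsPSDStabilizingSolution A G H X) (hY : IsPSDStabilizingSolution A G H Y) : X = Y := by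
  have key : ∀ {X Y}, IsPSDStabilizingSolution A G H X → IsPSDStabilizingSolution A G H Y →
      (X - Y).PosSemidef := by
    intro X Y hX hY
    have hXt := transpose_eq_of_posSemidef hX.1
    have hYt := transpose_eq_of_posSemidef hY.1
    -- The difference of the two equations is a Lyapunov equation for `A - G X` with term `(X - Y) G
    -- (X - Y)`.
    refine hX.2.2.posSemidef_of_lyapunov (hG.conjTranspose_mul_mul_same (X - Y)) ?_
    have h := (sub_eq_zero.2 (hX.2.1.trans hY.2.1.symm))
    rw [Matrix.conjTranspose_eq_transpose_of_trivial, Matrix.transpose_sub, Matrix.transpose_sub,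
      Matrix.transpose_mul, hXt, hYt, transpose_eq_of_posSemidef hG, ← h]
    noncomm_ring
  have h1 := key hX hY
  have h2 := key hY hX
  have h3 := h2.trace_nonneg
  rw [← neg_sub, Matrix.trace_neg] at h3
  exact sub_eq_zero.1 (h1.trace_eq_zero_iff.1 (by linarith [h1.trace_nonneg]))

/-- A supersolution of minimal trace is a stabilizing solution. -/
theorem exists_isPSDStabilizingSolution (hG : G.PosSemidef) (hH : H.PosSemidef)
    (hd : HasNoUnstableUnobservable A H) (hne : (riccatiSupersolutions A G H).Nonempty) :
    ∃ X, IsPSDStabilizingSolution A G H X := by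
  obtain ⟨X₀, hX₀⟩ := hne
  have htr : Continuous fun X : Matrix (Fin n) (Fin n) ℝ => X.trace := by fun_prop
  have hK : IsCompact (riccatiSupersolutions A G H ∩ {X | X.trace ≤ X₀.trace}) := by
    refine IsCompact.of_isClosed_subset
      (isCompact_univ_pi fun _ : Fin n => isCompact_univ_pi fun _ : Fin n =>
        isCompact_Icc (a := -X₀.trace) (b := X₀.trace))
      ((isClosed_riccatiSupersolutions A G H).inter (isClosed_le htr continuous_const)) ?_
    rintro X ⟨hX, hX'⟩ i - j -
    exact abs_le.1 ((abs_apply_le_trace hX.1 i j).trans hX')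
  obtain ⟨X, ⟨hX, hX'⟩, hmin⟩ := hK.exists_isMinOn ⟨X₀, hX₀, le_refl X₀.trace⟩ htr.continuousOn
  obtain ⟨Y, hY, hXY, hric⟩ := exists_newton_step hG hH hd hX
  have h1 := hXY.trace_nonneg
  rw [Matrix.trace_sub] at h1
  have h2 : X.trace ≤ Y.trace := hmin ⟨hY, (sub_nonneg.1 h1).trans hX'⟩
  have h3 : X - Y = 0 := hXY.trace_eq_zero_iff.1 (by rw [Matrix.trace_sub]; linarith)
  rw [h3, Matrix.zero_mul, Matrix.zero_mul, neg_zero] at hric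
  exact ⟨Y, hY.1, hric, isStable_of_mem_riccatiSupersolutions hG hH hd hY⟩

/-- A stabilizing feedback yields a supersolution. -/
theorem IsStabilizable.nonempty_riccatiSupersolutions {m : ℕ} {B : Matrix (Fin n) (Fin m) ℝ}
    {S : Matrix (Fin m) (Fin m) ℝ} (hS : S.PosDef) (hH : H.PosSemidef) (h : IsStabilizable A B) :
    (riccatiSupersolutions A (B * S⁻¹ * Bᵀ) H).Nonempty := by
  obtain ⟨F, hF⟩ := h
  have hW : (H + Fᵀ * S * F).PosSemidef := hH.add (hS.posSemidef.conjTranspose_mul_mul_same F)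
  obtain ⟨X, hX⟩ := hF.exists_lyapunov (H + Fᵀ * S * F)
  have hXP := hF.posSemidef_of_lyapunov hW hX
  refine ⟨X, hXP, ?_⟩
  have hu : IsUnit S.det := (Matrix.isUnit_iff_isUnit_det _).1 hS.isUnit
  have hSt := transpose_eq_of_posSemidef hS.posSemidef
  have hSi : (S⁻¹)ᵀ = S⁻¹ := by rw [Matrix.transpose_nonsing_inv, hSt]
  -- Completing the square: this is exactly `-riccati` at `X`.
  have hE := hS.posSemidef.conjTranspose_mul_mul_same (F + S⁻¹ * Bᵀ * X)
  convert! hE using 1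
  have h1 : (F + S⁻¹ * Bᵀ * X)ᵀ * S * (F + S⁻¹ * Bᵀ * X) = Fᵀ * S * F
      + Fᵀ * (S * S⁻¹) * Bᵀ * X + X * B * (S⁻¹ * S) * F
      + X * B * (S⁻¹ * S) * S⁻¹ * Bᵀ * X := by
    simp only [Matrix.transpose_add, Matrix.transpose_mul, Matrix.transpose_transpose, hSi,
      transpose_eq_of_posSemidef hXP, Matrix.add_mul, Matrix.mul_add, Matrix.mul_assoc]
    abel
  rw [Matrix.conjTranspose_eq_transpose_of_trivial, h1, Matrix.mul_nonsing_inv _ hu,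
    Matrix.nonsing_inv_mul _ hu, ← add_zero (-_), ← hX, riccati]
  simp only [Matrix.transpose_add, Matrix.transpose_mul, Matrix.add_mul, Matrix.mul_add,
    Matrix.mul_assoc, Matrix.mul_one]
  abel

/-- The stable matrix `A + Fᵀ C` agrees with `A` on the kernel of `C`. -/
theorem IsDetectable.hasNoUnstableUnobservable {l : ℕ} {C : Matrix (Fin l) (Fin n) ℝ}
    (h : IsDetectable C A) {a b : Fin n → ℝ} (hab : IsUnstablePair A a b)
    (ha : C *ᵥ a = 0) (hb : C *ᵥ b = 0) : a = 0 ∧ b = 0 := by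
  obtain ⟨F, hF⟩ := h
  have hF' : IsStable (A + Fᵀ * C) := by
    refine IsStable.of_transpose ?_
    simpa using hF
  have hker : ∀ c, C *ᵥ c = 0 → (A + Fᵀ * C) *ᵥ c = A *ᵥ c := by
    intro c hc
    rw [Matrix.add_mulVec, ← Matrix.mulVec_mulVec, hc, Matrix.mulVec_zero, add_zero]
  refine (isStable_iff_forall_isUnstablePair _).1 hF' a b ?_
  rwa [IsUnstablePair, hker a ha, hker b hb]

end Riccati

/-! ### Definiteness of the coefficients. -/

section Coefficients

variable {n m r : ℕ} {A Q : Matrix (Fin n) (Fin n) ℝ} {B L : Matrix (Fin n) (Fin m) ℝ}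
  {R : Matrix (Fin m) (Fin m) ℝ} {A₀ : Fin r → Matrix (Fin n) (Fin n) ℝ}
  {B₀ : Fin r → Matrix (Fin n) (Fin m) ℝ} {X : Matrix (Fin n) (Fin n) ℝ}

theorem Rc_posDef (hR : R.PosDef) (hX : X.PosSemidef) : (Rc R B₀ X).PosDef :=
  hR.add_posSemidef (Matrix.posSemidef_sum _ fun i _ => hX.conjTranspose_mul_mul_same (B₀ i))

theorem Gc_posSemidef (hR : R.PosDef) (hX : X.PosSemidef) : (Gc B R B₀ X).PosSemidef :=
  (Rc_posDef hR hX).inv.posSemidef.mul_mul_conjTranspose_same B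

/-- `H_c(X)` as a sum of three squares. -/
theorem Hc_eq (hR : R.PosDef) (hX : X.PosSemidef) {K : Matrix (Fin m) (Fin n) ℝ}
    (hK : K = (Rc R B₀ X)⁻¹ * (Lc L A₀ B₀ X)ᵀ) :
    Hc Q L R A₀ B₀ X = (Q - L * R⁻¹ * Lᵀ) + (R⁻¹ * Lᵀ - K)ᵀ * R * (R⁻¹ * Lᵀ - K)
      + ∑ i, (A₀ i - B₀ i * K)ᵀ * X * (A₀ i - B₀ i * K) := by
  have hSd := Rc_posDef (B₀ := B₀) hR hX
  have hSu : IsUnit (Rc R B₀ X).det := (Matrix.isUnit_iff_isUnit_det _).1 hSd.isUnit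
  have hRu : IsUnit R.det := (Matrix.isUnit_iff_isUnit_det _).1 hR.isUnit
  have hSi := transpose_eq_of_posSemidef hSd.inv.posSemidef
  have hRi := transpose_eq_of_posSemidef hR.inv.posSemidef
  have hXt := transpose_eq_of_posSemidef hX
  have h1 : Kᵀ * (Rc R B₀ X) * K = Lc L A₀ B₀ X * K := by
    rw [hK, Matrix.transpose_mul, Matrix.transpose_transpose, hSi,
      Matrix.nonsing_inv_mul_cancel_right _ _ hSu]
  have h2 : Kᵀ * (Lc L A₀ B₀ X)ᵀ = Lc L A₀ B₀ X * K := by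
    rw [hK, Matrix.transpose_mul, Matrix.transpose_transpose, hSi, Matrix.mul_assoc]
  -- For fixed `K` this form is linear in the blocks `Qc`, `Lc`, `Rc`, so each summand completes to
  -- its own square.
  have h3 : Hc Q L R A₀ B₀ X = Qc Q A₀ X - Lc L A₀ B₀ X * K - Kᵀ * (Lc L A₀ B₀ X)ᵀ
      + Kᵀ * (Rc R B₀ X) * K := by
    rw [h1, h2, Hc, Matrix.mul_assoc, ← hK]
    abel
  have h4 : (R⁻¹ * Lᵀ - K)ᵀ * R * (R⁻¹ * Lᵀ - K) = L * R⁻¹ * Lᵀ - L * K - Kᵀ * Lᵀ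
      + Kᵀ * R * K := by
    have e1 : L * R⁻¹ * R = L := Matrix.nonsing_inv_mul_cancel_right _ _ hRu
    have e2 : R * (R⁻¹ * Lᵀ) = Lᵀ := Matrix.mul_nonsing_inv_cancel_left _ _ hRu
    rw [Matrix.transpose_sub, Matrix.transpose_mul, Matrix.transpose_transpose, hRi,
      Matrix.sub_mul, e1, Matrix.sub_mul, Matrix.mul_sub, Matrix.mul_sub, Matrix.mul_assoc Kᵀ R,
      e2, Matrix.mul_assoc L R⁻¹]
    abel
  rw [h3, h4, Qc, Lc, Rc]
  simp only [Matrix.transpose_add, Matrix.transpose_sub, Matrix.transpose_sum,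
    Matrix.transpose_mul, Matrix.transpose_transpose, hXt, Matrix.add_mul, Matrix.mul_add,
    Matrix.sub_mul, Matrix.mul_sub, Matrix.sum_mul,
    Matrix.mul_sum, Finset.sum_sub_distrib, Matrix.mul_assoc]
  abel

end Coefficients

end SCARE

end

theorem theorem2p3 {n m r l : ℕ}
    (A Q : Matrix (Fin n) (Fin n) ℝ) (B L : Matrix (Fin n) (Fin m) ℝ)
    (R : Matrix (Fin m) (Fin m) ℝ)
    (A₀ : Fin r → Matrix (Fin n) (Fin n) ℝ) (B₀ : Fin r → Matrix (Fin n) (Fin m) ℝ)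
    (C : Matrix (Fin l) (Fin n) ℝ)
    (hR : R.PosDef)
    (hC : Cᵀ * C = Q - L * R⁻¹ * Lᵀ)
    (hker : LinearMap.ker C.mulVecLin ≤
      (⨅ i, LinearMap.ker (A₀ i).mulVecLin) ⊓ LinearMap.ker Lᵀ.mulVecLin)
    (hstab : SCARE.IsStabilizable A B)
    (hdet : SCARE.IsDetectable C A)
    (Xk : Matrix (Fin n) (Fin n) ℝ) (hXk : Xk.PosSemidef) :
    ∃! X : Matrix (Fin n) (Fin n) ℝ,
      SCARE.IsPSDStabilizingSolution (SCARE.Ac A B L R A₀ B₀ Xk) (SCARE.Gc B R B₀ Xk)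
        (SCARE.Hc Q L R A₀ B₀ Xk) X := by
  obtain ⟨K, hK⟩ : ∃ K, K = (SCARE.Rc R B₀ Xk)⁻¹ * (SCARE.Lc L A₀ B₀ Xk)ᵀ := ⟨_, rfl⟩
  have hA : SCARE.Ac A B L R A₀ B₀ Xk = A - B * K := by
    rw [SCARE.Ac, Matrix.mul_assoc, ← hK]
  have hG : (SCARE.Gc B R B₀ Xk).PosSemidef := SCARE.Gc_posSemidef hR hXk
  have h1 : (Cᵀ * C).PosSemidef := Matrix.posSemidef_conjTranspose_mul_self C
  have h2 : ((R⁻¹ * Lᵀ - K)ᵀ * R * (R⁻¹ * Lᵀ - K)).PosSemidef :=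
    hR.posSemidef.conjTranspose_mul_mul_same _
  have h3 : (∑ i, (A₀ i - B₀ i * K)ᵀ * Xk * (A₀ i - B₀ i * K)).PosSemidef :=
    Matrix.posSemidef_sum _ fun i _ => hXk.conjTranspose_mul_mul_same _
  have hHeq := SCARE.Hc_eq (Q := Q) hR hXk hK
  rw [← hC] at hHeq
  have hH : (SCARE.Hc Q L R A₀ B₀ Xk).PosSemidef := by
    rw [hHeq]
    exact (h1.add h2).add h3
  have hHker : ∀ c, SCARE.Hc Q L R A₀ B₀ Xk *ᵥ c = 0 → C *ᵥ c = 0 ∧ (A - B * K) *ᵥ c = A *ᵥ c := by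
    intro c hc
    rw [hHeq] at hc
    obtain ⟨e1, e2⟩ := SCARE.mulVec_eq_zero_of_add h1 h2
      (SCARE.mulVec_eq_zero_of_add (h1.add h2) h3 hc).1
    have hCc : C *ᵥ c = 0 := by
      have : (Cᴴ * C) *ᵥ c = 0 := e1
      exact (Matrix.conjTranspose_mul_self_mulVec_eq_zero C c).1 this
    have hLc : Lᵀ *ᵥ c = 0 := (hker (x := c) hCc).2
    have hRc := SCARE.mulVec_eq_zero_of_transpose_mul_mul hR.posSemidef e2
    have hKc : K *ᵥ c = 0 := by
      have := (Matrix.mulVec_injective_of_isUnit hR.isUnit) (hRc.trans (Matrix.mulVec_zero R).symm)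
      rwa [Matrix.sub_mulVec, ← Matrix.mulVec_mulVec, hLc, Matrix.mulVec_zero, zero_sub,
        neg_eq_zero] at this
    refine ⟨hCc, ?_⟩
    rw [Matrix.sub_mulVec, ← Matrix.mulVec_mulVec, hKc, Matrix.mulVec_zero, sub_zero]
  have hd : SCARE.HasNoUnstableUnobservable (A - B * K) (SCARE.Hc Q L R A₀ B₀ Xk) := by
    intro a b hab ha hb
    rw [SCARE.IsUnstablePair, (hHker a ha).2, (hHker b hb).2] at hab
    exact hdet.hasNoUnstableUnobservable hab (hHker a ha).1 (hHker b hb).1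
  have hs : SCARE.IsStabilizable (A - B * K) B := by
    obtain ⟨F, hF⟩ := hstab
    -- The shift cancels: `A - B K + B (F + K) = A + B F`.
    refine ⟨F + K, ?_⟩
    rwa [Matrix.mul_add, sub_add_add_cancel]
  rw [hA]
  obtain ⟨X, hX⟩ := SCARE.exists_isPSDStabilizingSolution hG hH hd
    (hs.nonempty_riccatiSupersolutions (SCARE.Rc_posDef hR hXk) hH)
  exact ⟨X, hX, fun Y hY => hY.unique hG hX⟩
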